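/- **Setting.** Let $\mathcal Z$ be a Polish space with its Borel $\sigma$-algebra, $\mathcal P$ a set of probability measures on $\mathcal Z$, and let the model $\mathcal F$ and the nonempty decision set $\mathcal F_D$ be subsets of a real vector space. Let $\ell_f(z)\in[0,\infty]$ be a loss. Assume that $\mathcal F$ carries a $\sigma$-algebra for which $g\mapsto \ell_g(z)$ is measurable on $\mathcal F$ for every $z$, and let $\Delta(\mathcal F)$ be the set of probability measures on $\mathcal F$. Write $R(P,f)=\mathbb E_{Z\sim P}[\ell_f(Z)]$ and assume that for every $P\in\mathcal P$ there is $f^\circ\in\mathcal F$ with $R(P,f^\circ)<\infty$. Fix $\eta>0$. For $\Pi\in\Delta(\mathcal F)$ put $$\xi^\Pi_{z,f}=\mathbb E_{g\sim\Pi}\big[e^{\eta(\ell_f(z)-\ell_g(z))}\big],\qquad S_\Pi^\eta(P,f)=\mathbb E_{Z\sim P}\big[\xi^\Pi_{Z,f}\big]\in[0,\infty],$$ where $e^{\eta(a-b)}$ is read as $\infty$ if $a=\infty$ (also when $b=\infty$), and as $0$ if $a<\infty=b$. **Assumption D** (for $\eta$ and a given $\Pi\in\Delta(\mathcal F)$):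 1. for all $f\in\mathcal F\cup\mathcal F_D$, $z\mapsto\ell_f(z)\in[0,\infty]$ is continuous; 2. $\mathcal F_D$ is convex and, for every $z\in\mathcal Z$, $f\mapsto e^{\eta\ell_f(z)}\in[1,\infty]$ is convex on $\mathcal F_D$; 3. $\mathcal P$ is convex and tight; 4. either (a) $\mathcal P$ is closed in the weak topology, or (b) $\mathcal F_D$ is a totally bounded metric space (for some metric) such that, for every compact $\mathcal Z'\subseteq\mathcal Z$, the functions $f\mapsto\ell_f(z)$, $z\in\mathcal Z'$, are uniformly equicontinuous on $\mathcal F_D$, i.e. for every $\epsilon>0$ there is $\delta>0$ such that $\ell_f(z)\le\ell_g(z)+\epsilon$ for all $z\in\mathcal Z'$ and all $f,g\in\mathcal F_D$ with $d(f,g)<\delta$; 5. $\displaystyle\lim_{b\to\infty}\ \sup_{f\in\mathcal F_D,\,P\in\mathcal P}\mathbb E_{Z\sim P}\big[\xi^\Pi_{Z,f}\mathbf 1\{\xi^\Pi_{Z,f}\ge b\}\big]=0.$ **Definitions.** The *weak $\eta$-central condition* holds for $(\ell,\mathcal P,\mathcal F)$ if for every $\epsilon>0$ there is $\phi:\mathcal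 P\to\mathcal F$ with $S_\Pi^\eta(P,\phi(P))\le e^{\eta\epsilon}$ for all $P\in\mathcal P$ and $\Pi\in\Delta(\mathcal F)$. The *weak $\eta$-predictor condition* holds for $(\ell,\mathcal P,\mathcal F,\mathcal F_D)$ if for every $\epsilon>0$ there is $\psi:\Delta(\mathcal F)\to\mathcal F_D$ with $S_\Pi^\eta(P,\psi(\Pi))\le e^{\eta\epsilon}$ for all $P\in\mathcal P$ and $\Pi\in\Delta(\mathcal F)$. *Strong relative well-specification* means that for every $P\in\mathcal P$ one has $\inf_{f\in\mathcal F}R(P,f)=\inf_{f\in\mathcal F_D}R(P,f)$ and both infima are attained. **Theorem.** (i) If Assumption D holds for a given $\Pi\in\Delta(\mathcal F)$, then the minimax identity holds for that $\Pi$: $$\sup_{P\in\mathcal P}\inf_{f\in\mathcal F_D}S_\Pi^\eta(P,f)=\inf_{f\in\mathcal F_D}\sup_{P\in\mathcal P}S_\Pi^\eta(P,f).$$ (ii) Consequently, if Assumption D holds for all $\Pi\in\Delta(\mathcal F)$, then the $\eta$-minimax assumption holds: for all $\Pi\in\Delta(\mathcal F)$ and all real $C\ge1$, $\sup_{P\in\mathcal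 P}\inf_{f\in\mathcal F_D}S_\Pi^\eta(P,f)\le C$ implies $\inf_{f\in\mathcal F_D}\sup_{P\in\mathcal P}S_\Pi^\eta(P,f)\le C$. (iii) Suppose that Assumption D holds for all $\Pi\in\Delta(\mathcal F)$, and that either $\mathcal F=\mathcal F_D$, or $\mathcal F\supseteq\mathcal F_D$ and strong relative well-specification holds. Then the weak $\eta$-central condition for $(\ell,\mathcal P,\mathcal F)$ implies the weak $\eta$-predictor condition for $(\ell,\mathcal P,\mathcal F,\mathcal F_D)$. -/

import Mathlib

open MeasureTheory Filter Topology Set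
open scoped ENNReal NNReal

namespace FastRates

noncomputable section

/-! A decision problem is given by a loss `ℓ f z ∈ [0, ∞]`, a set `Ps` of distributions on the
outcome space `Z`, a model `F` and a decision set `FD`. Both `F` and `FD` are subsets of an ambient
real vector space `V`, and `Δ(F)` is the type `ProbabilityMeasure F`. -/

variable {V Z : Type*} [AddCommGroup V] [Module ℝ V] [MeasurableSpace V]
  [TopologicalSpace Z] [MeasurableSpace Z] [BorelSpace Z]

/-- `e ^ (η a)` for a loss value `a ∈ [0, ∞]`, with `e ^ ∞ = ∞`. -/
def expLoss (η : ℝ) (a : ℝ≥0∞) : ℝ≥0∞ :=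
  EReal.exp ((η : EReal) * (a : EReal))

open Classical in
/-- `e ^ (η (a - b))` for loss values `a, b ∈ [0, ∞]`. For `b = ∞` and finite `a` this is
`e ^ (-∞) = 0`. For `a = ∞` it is `∞`; in particular the undefined expression `∞ - ∞` is never
counted as satisfying an upper bound. -/
def expExcess (η : ℝ) (a b : ℝ≥0∞) : ℝ≥0∞ :=
  if a = ∞ then ∞ else EReal.exp ((η : EReal) * ((a : EReal) - (b : EReal)))

/-- The risk `R(P, f) = E_{Z ∼ P} [ℓ_f(Z)]`. -/
def risk (ℓ : V → Z → ℝ≥0∞) (P : ProbabilityMeasure Z) (f : V) : ℝ≥0∞ :=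
  ∫⁻ z, ℓ f z ∂(P : Measure Z)

/-- `ξ_{z,f} = E_{g ∼ Π} [e ^ (η (ℓ_f(z) - ℓ_g(z)))]`. -/
def xi (ℓ : V → Z → ℝ≥0∞) (F : Set V) (η : ℝ) (Q : ProbabilityMeasure F) (f : V) (z : Z) : ℝ≥0∞ :=
  ∫⁻ g : F, expExcess η (ℓ f z) (ℓ g z) ∂(Q : Measure F)

/-- `S_Π^η(P, f) = E_{Z ∼ P} E_{g ∼ Π} [e ^ (η (ℓ_f(Z) - ℓ_g(Z)))]`. -/
def S (ℓ : V → Z → ℝ≥0∞) (F : Set V) (η : ℝ) (Q : ProbabilityMeasure F)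
    (P : ProbabilityMeasure Z) (f : V) : ℝ≥0∞ :=
  ∫⁻ z, xi ℓ F η Q f z ∂(P : Measure Z)

/-- The `η`-central condition up to `ε`, with comparator selection function `φ : Ps → F`. -/
def CentralUpTo (ℓ : V → Z → ℝ≥0∞) (Ps : Set (ProbabilityMeasure Z)) (F : Set V) (η ε : ℝ) : Prop :=
  ∃ φ : Ps → F, ∀ (P : Ps) (Q : ProbabilityMeasure F),
    S ℓ F η Q P (φ P) ≤ ENNReal.ofReal (Real.exp (η * ε))

/-- The weak `η`-central condition. -/
def WeakCentral (ℓ : V → Z → ℝ≥0∞) (Ps : Set (ProbabilityMeasure Z)) (F : Set V) (η : ℝ) : Prop :=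
  ∀ ε : ℝ, 0 < ε → CentralUpTo ℓ Ps F η ε

/-- The `η`-predictor condition up to `ε`, with prediction function `ψ : Δ(F) → FD`. -/
def PredictorUpTo (ℓ : V → Z → ℝ≥0∞) (Ps : Set (ProbabilityMeasure Z)) (F FD : Set V)
    (η ε : ℝ) : Prop :=
  ∃ ψ : ProbabilityMeasure F → FD, ∀ (P : Ps) (Q : ProbabilityMeasure F),
    S ℓ F η Q P (ψ Q) ≤ ENNReal.ofReal (Real.exp (η * ε))

/-- The weak `η`-predictor condition. -/
def WeakPredictor (ℓ : V → Z → ℝ≥0∞) (Ps : Set (ProbabilityMeasure Z)) (F FD : Set V)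
    (η : ℝ) : Prop :=
  ∀ ε : ℝ, 0 < ε → PredictorUpTo ℓ Ps F FD η ε

/-- Strong relative well-specification: for each `P ∈ Ps` the infimal risks over `F` and over `FD`
agree and both are attained. -/
def StronglyWellSpecified (ℓ : V → Z → ℝ≥0∞) (Ps : Set (ProbabilityMeasure Z))
    (F FD : Set V) : Prop :=
  ∀ P ∈ Ps,
    (⨅ f ∈ F, risk ℓ P f) = (⨅ f ∈ FD, risk ℓ P f) ∧
    (∃ f ∈ F, risk ℓ P f = ⨅ g ∈ F, risk ℓ P g) ∧
    (∃ f ∈ FD, risk ℓ P f = ⨅ g ∈ FD, risk ℓ P g)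

/-- The minimax identity `sup_P inf_f S_Π^η(P, f) = inf_f sup_P S_Π^η(P, f)`, with `P` ranging over
`Ps` and `f` over `FD`. -/
def MinimaxIdentity (ℓ : V → Z → ℝ≥0∞) (Ps : Set (ProbabilityMeasure Z)) (F FD : Set V) (η : ℝ)
    (Q : ProbabilityMeasure F) : Prop :=
  (⨆ P ∈ Ps, ⨅ f ∈ FD, S ℓ F η Q P f) = ⨅ f ∈ FD, ⨆ P ∈ Ps, S ℓ F η Q P f

/-- The `η`-minimax assumption. -/
def MinimaxAssumption (ℓ : V → Z → ℝ≥0∞) (Ps : Set (ProbabilityMeasure Z)) (F FD : Set V)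
    (η : ℝ) : Prop :=
  ∀ (Q : ProbabilityMeasure F) (C : ℝ), 1 ≤ C →
    (⨆ P ∈ Ps, ⨅ f ∈ FD, S ℓ F η Q P f) ≤ ENNReal.ofReal C →
    (⨅ f ∈ FD, ⨆ P ∈ Ps, S ℓ F η Q P f) ≤ ENNReal.ofReal C

/-- `FD` is a totally bounded metric space for some metric for which, on every compact set `K` of
outcomes, the functions `f ↦ ℓ_f(z)`, `z ∈ K`, are uniformly equicontinuous on `FD`. -/
def TotallyBoundedEquicontinuous (ℓ : V → Z → ℝ≥0∞) (FD : Set V) : Prop :=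
  ∃ _ : MetricSpace FD, TotallyBounded (univ : Set FD) ∧
    ∀ K : Set Z, IsCompact K → ∀ ε : ℝ, 0 < ε → ∃ δ : ℝ, 0 < δ ∧
      ∀ f g : FD, dist f g < δ → ∀ z ∈ K, ℓ f z ≤ ℓ g z + ENNReal.ofReal ε

/-- The convexity, continuity, tightness and uniform integrability conditions for a given
distribution `Q` on `F` and a given `η`. Nonnegativity of the loss is part of its type. -/
structure AssumptionD (ℓ : V → Z → ℝ≥0∞) (Ps : Set (ProbabilityMeasure Z)) (F FD : Set V)
    (η : ℝ) (Q : ProbabilityMeasure F) : Prop where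
  continuous_loss : ∀ f ∈ F ∪ FD, Continuous (ℓ f)
  convex_decisions : Convex ℝ FD
  convex_expLoss : ∀ z, ConvexOn ℝ≥0 FD (fun f => expLoss η (ℓ f z))
  convex_distributions : Convex ℝ≥0 ((fun P : ProbabilityMeasure Z => (P : Measure Z)) '' Ps)
  tight : IsTightMeasureSet ((fun P : ProbabilityMeasure Z => (P : Measure Z)) '' Ps)
  closed_or_equicontinuous : IsClosed Ps ∨ TotallyBoundedEquicontinuous ℓ FD
  uniformly_integrable :
    Tendsto (fun b : ℝ => ⨆ f ∈ FD, ⨆ P ∈ Ps,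
      ∫⁻ z, {z | ENNReal.ofReal b ≤ xi ℓ F η Q f z}.indicator (xi ℓ F η Q f) z ∂(P : Measure Z))
      atTop (𝓝 0)

end

end FastRates

/-! The nontrivial half of the minimax identity is a separation argument plus a reduction to
finitely many decisions. Let `c` lie below the inf-sup. The gap `S` is affine in `P`, convex in `f`,
and finite by uniform integrability, so separating convex sets in a finite-dimensional space yields,
for any finitely many decisions, one `P` that exceeds `c` at all of them
(`exists_forall_lt_of_convexOn`). Finitely many decisions suffice in both cases. If `Ps` is closed,
tightness makes it compact, and `S` is upper semicontinuous in `P`, so a finite subcover applies. In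
the equicontinuous case a finite net of decisions is used: on a large compact set nearby decisions
have comparable gaps, and off it uniform integrability bounds the rest. For the predictor condition
it remains to bound the infimum of `S` over `FD` for each `P`. If `FD` is smaller than `F`, the risk
minimizer `f₀` in `FD` also minimizes over `F`. Central comparators `f n` at levels tending to zero
then have losses converging almost surely to that of `f₀`, because the defect in `1 + x ≤ e ^ x`
vanishes; Fatou's lemma gives `S ≤ 1` at `f₀`. -/

namespace FastRates

/-! ### A finite minimax theorem -/

/-- Let `T P f` be convex in `f ∈ FD` and concave-like in `P ∈ Ps`. If no single `f ∈ FD` satisfies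
`T P f ≤ c` for all `P ∈ Ps`, then for finitely many decisions some `P ∈ Ps` exceeds `c` at all of
them simultaneously. -/
theorem exists_forall_lt_of_convexOn {X V ι : Type*} [AddCommGroup V] [Module ℝ V] [Fintype ι]
    {Ps : Set X} {FD : Set V} {T : X → V → ℝ} (hne : FD.Nonempty)
    (hconv : ∀ P ∈ Ps, ConvexOn ℝ FD (T P))
    (hmix : ∀ P ∈ Ps, ∀ P' ∈ Ps, ∀ a b : ℝ, 0 ≤ a → 0 ≤ b → a + b = 1 →
      ∃ R ∈ Ps, ∀ f ∈ FD, a * T P f + b * T P' f ≤ T R f)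
    {c : ℝ} (hc : ∀ f ∈ FD, ∃ P ∈ Ps, c < T P f) (y : ι → V) (hy : ∀ i, y i ∈ FD) :
    ∃ P ∈ Ps, ∀ i, c < T P (y i) := by
  classical
  by_contra! hcon
  obtain ⟨f₀, hf₀⟩ := hne
  obtain ⟨P₀, hP₀, -⟩ := hc f₀ hf₀
  -- The set `t` is the downward closure of the payoff vectors: this makes it convex under the
  -- inequality `hmix` and forces the separating weights to be nonnegative.
  set s : Set (ι → ℝ) := univ.pi fun _ => Ioi c
  set t : Set (ι → ℝ) := {x | ∃ P ∈ Ps, ∀ i, x i ≤ T P (y i)}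
  have hs_conv : Convex ℝ s := convex_pi fun _ _ => convex_Ioi c
  have hs_open : IsOpen s := isOpen_set_pi finite_univ fun _ _ => isOpen_Ioi
  have ht_conv : Convex ℝ t := by
    rintro x ⟨P, hP, hx⟩ x' ⟨P', hP', hx'⟩ a b ha hb hab
    obtain ⟨R, hR, hR'⟩ := hmix P hP P' hP' a b ha hb hab
    refine ⟨R, hR, fun i => le_trans ?_ (hR' _ (hy i))⟩
    simp only [Pi.add_apply, Pi.smul_apply, smul_eq_mul]
    gcongr
    · exact hx i
    · exact hx' i
  have hdisj : Disjoint s t := by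
    rw [Set.disjoint_left]
    rintro x hx ⟨P, hP, hxP⟩
    obtain ⟨i, hi⟩ := hcon P hP
    exact absurd (lt_of_lt_of_le (hx i (mem_univ i)) (hxP i)) (not_lt.2 hi)
  obtain ⟨φ, u, hφs, hφt⟩ := geometric_hahn_banach_open hs_conv hs_open ht_conv hdisj
  set w : ι → ℝ := fun i => -φ (Pi.single i 1) with hw
  have hφ : ∀ x : ι → ℝ, φ x = -∑ i, w i * x i := by
    intro x
    conv_lhs => rw [pi_eq_sum_univ' x]
    rw [map_sum, ← Finset.sum_neg_distrib]
    refine Finset.sum_congr rfl fun i _ => ?_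
    simp only [hw, map_smul, smul_eq_mul]
    ring
  have hw0 : ∀ i, 0 ≤ w i := by
    intro i
    by_contra! hi
    set x₀ : ι → ℝ := fun j => T P₀ (y j)
    have key : ∀ r : ℝ, 0 ≤ r → u ≤ φ x₀ + r * w i := by
      intro r hr
      have := hφt (x₀ - r • Pi.single i 1) ⟨P₀, hP₀, fun j => by
        by_cases hj : j = i
        · subst hj; simp [x₀, hr]
        · simp [x₀, hj]⟩
      rw [map_sub, map_smul, smul_eq_mul] at this
      simp only [hw]
      linarith
    -- This `r` brings the right-hand side of `key` down to `u - 1`.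
    have h1 := key ((φ x₀ - u + 1) / (-w i))
      (div_nonneg (by linarith [key 0 le_rfl]) (by linarith))
    have h2 : (φ x₀ - u + 1) / (-w i) * w i = -(φ x₀ - u + 1) := by
      rw [div_neg, neg_mul, div_mul_cancel₀ _ hi.ne]
    linarith
  have hconst : ∀ r, c < r → -(r * ∑ i, w i) < u := by
    intro r hr
    have := hφs (fun _ => r) fun i _ => hr
    rwa [hφ, ← Finset.sum_mul, mul_comm] at this
  have hval : ∀ P ∈ Ps, ∑ i, w i * T P (y i) ≤ -u := by
    intro P hP
    have := hφt (fun i => T P (y i)) ⟨P, hP, fun i => le_rfl⟩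
    rw [hφ] at this
    linarith
  have hΛ : 0 < ∑ i, w i := by
    refine lt_of_le_of_ne (Finset.sum_nonneg fun i _ => hw0 i) fun h => ?_
    have h0 : ∀ i, w i = 0 := fun i =>
      (Finset.sum_eq_zero_iff_of_nonneg fun i _ => hw0 i).1 h.symm i (Finset.mem_univ i)
    have h1 := hconst (c + 1) (by linarith)
    have h2 := hval P₀ hP₀
    simp only [h0, zero_mul, Finset.sum_const_zero, mul_zero, neg_zero] at h1 h2
    linarith
  have hu : -u ≤ c * ∑ i, w i := by
    refine le_of_forall_pos_lt_add fun ε hε => ?_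
    have := hconst (c + ε / ∑ i, w i) (by linarith [div_pos hε hΛ])
    rw [add_mul, div_mul_cancel₀ _ hΛ.ne'] at this
    linarith
  -- The normalized weights mix the `y i` into a single decision whose payoff is at most `c` under
  -- every `P`, contradicting `hc`.
  have hμ0 : ∀ i ∈ Finset.univ, 0 ≤ w i / ∑ i, w i := fun i _ => div_nonneg (hw0 i) hΛ.le
  have hμ1 : ∑ i, w i / ∑ i, w i = 1 := by rw [← Finset.sum_div, div_self hΛ.ne']
  have hmem := (hconv P₀ hP₀).1.sum_mem hμ0 hμ1 fun i _ => hy i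
  obtain ⟨P, hP, hlt⟩ := hc _ hmem
  have h1 := (hconv P hP).map_sum_le hμ0 hμ1 fun i _ => hy i
  have h2 : ∑ i, (w i / ∑ i, w i) • T P (y i) ≤ c := by
    have : ∑ i, (w i / ∑ i, w i) • T P (y i) = (∑ i, w i * T P (y i)) / ∑ i, w i := by
      rw [Finset.sum_div]
      exact Finset.sum_congr rfl fun i _ => by rw [smul_eq_mul]; ring
    rw [this, div_le_iff₀ hΛ]
    exact (hval P hP).trans hu
  linarith

end FastRates

namespace FastRates

/-! ### The exponential of a loss -/

section Exp

variable {η : ℝ}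

theorem expLoss_top (hη : 0 < η) : expLoss η ∞ = ∞ := by
  simp [expLoss, EReal.coe_mul_top_of_pos hη]

theorem expLoss_of_ne_top {a : ℝ≥0∞} (ha : a ≠ ∞) :
    expLoss η a = ENNReal.ofReal (Real.exp (η * a.toReal)) := by
  lift a to ℝ≥0 using ha
  rw [expLoss, ← EReal.exp_coe]
  norm_cast

theorem expLoss_eq_top_iff (hη : 0 < η) {a : ℝ≥0∞} : expLoss η a = ∞ ↔ a = ∞ := by
  constructor
  · intro h
    by_contra ha
    simp [expLoss_of_ne_top ha] at h
  · rintro rfl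
    exact expLoss_top hη

theorem expLoss_ne_zero (hη : 0 < η) (a : ℝ≥0∞) : expLoss η a ≠ 0 := by
  by_cases ha : a = ∞
  · simp [ha, expLoss_top hη]
  · simp [expLoss_of_ne_top ha, Real.exp_pos]

theorem one_le_expLoss (hη : 0 < η) (a : ℝ≥0∞) : 1 ≤ expLoss η a := by
  by_cases ha : a = ∞
  · simp [ha, expLoss_top hη]
  · rw [expLoss_of_ne_top ha, ENNReal.one_le_ofReal]
    exact Real.one_le_exp (by positivity)

theorem continuous_expLoss (hη : 0 < η) : Continuous (expLoss η) := by
  have h : Continuous fun x : EReal => (η : EReal) * x := by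
    refine continuous_iff_continuousAt.2 fun x => ?_
    have := EReal.continuousAt_mul (p := ((η : EReal), x))
      (Or.inl (by simpa using hη.ne')) (Or.inl (by simpa using hη.ne'))
      (Or.inl (by simp)) (Or.inl (by simp))
    exact this.comp (f := fun x : EReal => ((η : EReal), x)) (by fun_prop)
  exact ENNReal.continuous_exp.comp (h.comp continuous_coe_ennreal_ereal)

theorem expLoss_mono (hη : 0 < η) : Monotone (expLoss η) := by
  intro a b hab
  by_cases hb : b = ∞
  · simp [hb, expLoss_top hη]
  · have ha : a ≠ ∞ := ne_top_of_le_ne_top hb hab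
    rw [expLoss_of_ne_top ha, expLoss_of_ne_top hb]
    have := ENNReal.toReal_mono hb hab
    gcongr

theorem expLoss_add (hη : 0 < η) (a b : ℝ≥0∞) :
    expLoss η (a + b) = expLoss η a * expLoss η b := by
  by_cases ha : a = ∞
  · simp [ha, expLoss_top hη, ENNReal.top_mul, expLoss_ne_zero hη]
  by_cases hb : b = ∞
  · simp [hb, expLoss_top hη, ENNReal.mul_top, expLoss_ne_zero hη]
  rw [expLoss_of_ne_top ha, expLoss_of_ne_top hb, expLoss_of_ne_top (ENNReal.add_ne_top.2 ⟨ha, hb⟩),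
    ENNReal.toReal_add ha hb, ← ENNReal.ofReal_mul (Real.exp_nonneg _), ← Real.exp_add, mul_add]

theorem expExcess_top (b : ℝ≥0∞) : expExcess η ∞ b = ∞ := by simp [expExcess]

/-- The factorization separates `f` from `g`, so the average over `g` becomes a factor independent
of `f`. It survives `b = ∞` because `∞⁻¹ = 0`. -/
theorem expExcess_of_ne_top (hη : 0 < η) {a : ℝ≥0∞} (ha : a ≠ ∞) (b : ℝ≥0∞) :
    expExcess η a b = expLoss η a * (expLoss η b)⁻¹ := by
  rw [expExcess, if_neg ha]
  by_cases hb : b = ∞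
  · subst hb
    lift a to ℝ≥0 using ha
    rw [expLoss_top hη, ENNReal.inv_top, mul_zero]
    simp [EReal.sub_top, EReal.coe_mul_bot_of_pos hη]
  · rw [expLoss_of_ne_top ha, expLoss_of_ne_top hb,
      ← ENNReal.ofReal_inv_of_pos (Real.exp_pos _), ← Real.exp_neg,
      ← ENNReal.ofReal_mul (Real.exp_nonneg _), ← Real.exp_add, ← EReal.exp_coe]
    lift a to ℝ≥0 using ha
    lift b to ℝ≥0 using hb
    congr 1
    have : η * (a : ℝ) + -(η * (b : ℝ)) = η * ((a : ℝ) - b) := by ring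
    simp only [ENNReal.coe_toReal, this]
    norm_cast

end Exp

/-! ### The mixability gap `xi` -/

section Xi

variable {V Z : Type*} [MeasurableSpace V] {ℓ : V → Z → ℝ≥0∞} {F : Set V} {η : ℝ} {Q : ProbabilityMeasure F}

/-- `E_{g ∼ Π} [e ^ (-η ℓ_g(z))]`. -/
noncomputable def discount (ℓ : V → Z → ℝ≥0∞) (F : Set V) (η : ℝ) (Q : ProbabilityMeasure F)
    (z : Z) : ℝ≥0∞ :=
  ∫⁻ g : F, (expLoss η (ℓ g z))⁻¹ ∂(Q : Measure F)

theorem discount_le_one (hη : 0 < η) (z : Z) : discount ℓ F η Q z ≤ 1 :=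
  calc discount ℓ F η Q z ≤ ∫⁻ _ : F, 1 ∂(Q : Measure F) :=
        lintegral_mono fun g => ENNReal.inv_le_one.2 (one_le_expLoss hη _)
    _ = 1 := by simp

theorem discount_ne_top (hη : 0 < η) (z : Z) : discount ℓ F η Q z ≠ ∞ :=
  ne_top_of_le_ne_top ENNReal.one_ne_top (discount_le_one hη z)

/-- Dominated convergence with bound `1`, available because losses are nonnegative. -/
theorem continuous_discount [TopologicalSpace Z] [FirstCountableTopology Z] (hη : 0 < η)
    (hmeas : ∀ z : Z, Measurable fun g : F => ℓ g z) (hcont : ∀ f ∈ F, Continuous (ℓ f)) :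
    Continuous (discount ℓ F η Q) := by
  refine continuous_iff_continuousAt.2 fun z₀ => ?_
  refine tendsto_lintegral_filter_of_dominated_convergence (fun _ => 1)
    (Eventually.of_forall fun z =>
      ((continuous_expLoss hη).measurable.comp (hmeas z)).inv)
    (Eventually.of_forall fun z => Eventually.of_forall fun g =>
      ENNReal.inv_le_one.2 (one_le_expLoss hη _)) (by simp)
    (Eventually.of_forall fun g => ?_)
  exact (continuous_inv.comp
    ((continuous_expLoss hη).comp (hcont g g.2))).continuousAt

theorem xi_of_eq_top {f : V} {z : Z} (h : ℓ f z = ∞) : xi ℓ F η Q f z = ∞ := by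
  simp [xi, h, expExcess_top]

theorem xi_of_ne_top (hη : 0 < η) {f : V} {z : Z} (h : ℓ f z ≠ ∞) :
    xi ℓ F η Q f z = expLoss η (ℓ f z) * discount ℓ F η Q z := by
  simp only [xi, expExcess_of_ne_top hη h]
  exact lintegral_const_mul' _ _ (mt (expLoss_eq_top_iff hη).1 h)

theorem measurable_xi [TopologicalSpace Z] [FirstCountableTopology Z] [MeasurableSpace Z]
    [BorelSpace Z] (hη : 0 < η)
    (hmeas : ∀ z : Z, Measurable fun g : F => ℓ g z) (hcont : ∀ f ∈ F, Continuous (ℓ f))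
    {f : V} (hf : Continuous (ℓ f)) : Measurable (xi ℓ F η Q f) := by
  classical
  -- The product alone would give `∞ * 0 = 0` at an infinite loss with zero discount.
  have h : xi ℓ F η Q f = fun z => if ℓ f z = ∞ then ∞
      else expLoss η (ℓ f z) * discount ℓ F η Q z := by
    ext z
    split_ifs with hz
    · exact xi_of_eq_top hz
    · exact xi_of_ne_top hη hz
  rw [h]
  exact Measurable.ite (hf.measurable (measurableSet_singleton ∞)) measurable_const
    (((continuous_expLoss hη).comp hf).measurable.mul
      (continuous_discount hη hmeas hcont).measurable)

/-- Losses that differ by at most `ε` have gaps that differ by a factor of at most `e ^ (η ε)`. -/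
theorem xi_le_of_le_add (hη : 0 < η) {f g : V} {z : Z} {ε : ℝ} (hε : 0 ≤ ε)
    (h : ℓ f z ≤ ℓ g z + ENNReal.ofReal ε) :
    xi ℓ F η Q f z ≤ ENNReal.ofReal (Real.exp (η * ε)) * xi ℓ F η Q g z := by
  by_cases hg : ℓ g z = ∞
  · rw [xi_of_eq_top hg, ENNReal.mul_top (by simp [Real.exp_pos])]
    exact le_top
  have hf : ℓ f z ≠ ∞ := ne_top_of_le_ne_top (ENNReal.add_ne_top.2 ⟨hg, ENNReal.ofReal_ne_top⟩) h
  rw [xi_of_ne_top hη hg, xi_of_ne_top hη hf, ← mul_assoc]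
  gcongr
  calc expLoss η (ℓ f z) ≤ expLoss η (ℓ g z + ENNReal.ofReal ε) := expLoss_mono hη h
    _ = _ := by
      rw [expLoss_add hη, expLoss_of_ne_top ENNReal.ofReal_ne_top, ENNReal.toReal_ofReal hε,
        mul_comm]

/-- Where both losses are finite, the discount is a common factor. Elsewhere the right-hand side is
infinite, once zero weights are split off because of `0 * ∞ = 0`. -/
theorem xi_convex [AddCommGroup V] [Module ℝ V] (hη : 0 < η) {FD : Set V}
    (hconv : ∀ z, ConvexOn ℝ≥0 FD fun f => expLoss η (ℓ f z)) {f g : V} (hf : f ∈ FD)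
    (hg : g ∈ FD) {a b : ℝ≥0} (hab : a + b = 1) (z : Z) :
    xi ℓ F η Q (a • f + b • g) z ≤ a * xi ℓ F η Q f z + b * xi ℓ F η Q g z := by
  rcases eq_or_ne a 0 with rfl | ha
  · obtain rfl : b = 1 := by simpa using hab
    simp
  rcases eq_or_ne b 0 with rfl | hb
  · obtain rfl : a = 1 := by simpa using hab
    simp
  by_cases hfz : ℓ f z = ∞
  · simp [xi_of_eq_top hfz, ENNReal.mul_top, ha]
  by_cases hgz : ℓ g z = ∞
  · simp [xi_of_eq_top hgz, ENNReal.mul_top, hb]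
  have h := (hconv z).2 hf hg (zero_le : 0 ≤ a) (zero_le : 0 ≤ b) hab
  simp only [ENNReal.smul_def, smul_eq_mul] at h
  have htop : ℓ (a • f + b • g) z ≠ ∞ := by
    refine mt (expLoss_eq_top_iff hη).2 (ne_top_of_le_ne_top ?_ h)
    exact ENNReal.add_ne_top.2
      ⟨ENNReal.mul_ne_top ENNReal.coe_ne_top (mt (expLoss_eq_top_iff hη).1 hfz),
        ENNReal.mul_ne_top ENNReal.coe_ne_top (mt (expLoss_eq_top_iff hη).1 hgz)⟩
  rw [xi_of_ne_top hη htop, xi_of_ne_top hη hfz, xi_of_ne_top hη hgz, ← mul_assoc, ← mul_assoc,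
    ← add_mul]
  gcongr

end Xi

end FastRates

namespace FastRates

/-! ### The expected gap as a function of the outcome distribution -/

section Minimax

variable {V Z : Type*} [MeasurableSpace V] [MeasurableSpace Z]
  {ℓ : V → Z → ℝ≥0∞} {Ps : Set (ProbabilityMeasure Z)} {F FD : Set V} {η : ℝ}
  {Q : ProbabilityMeasure F}

theorem S_mix {P P' R : ProbabilityMeasure Z} {a b : ℝ≥0}
    (hR : (R : Measure Z) = a • (P : Measure Z) + b • (P' : Measure Z)) (f : V) :
    S ℓ F η Q R f = a * S ℓ F η Q P f + b * S ℓ F η Q P' f := by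
  simp only [S, hR, lintegral_add_measure, lintegral_smul_measure, ENNReal.smul_def, smul_eq_mul]

variable [TopologicalSpace Z] [BorelSpace Z]

/-- Continuity of the gap can fail where `∞ * 0` arises. Adding `1 / (k + 1)` to the discount
removes this, and truncation at `b` gives bounded continuous functions decreasing to the truncated
gap. The integral is thus an infimum of weakly continuous functionals. -/
theorem lintegral_min_upperSemicontinuous [FirstCountableTopology Z] (hη : 0 < η)
    (hmeas : ∀ z : Z, Measurable fun g : F => ℓ g z) (hcont : ∀ f ∈ F, Continuous (ℓ f))
    {f : V} (hf : Continuous (ℓ f)) (b : ℝ≥0) :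
    UpperSemicontinuous fun P : ProbabilityMeasure Z =>
      ∫⁻ z, min (b : ℝ≥0∞) (xi ℓ F η Q f z) ∂(P : Measure Z) := by
  set h : ℕ → Z → ℝ≥0∞ := fun k z =>
    min (b : ℝ≥0∞) (expLoss η (ℓ f z) * (discount ℓ F η Q z + ((k : ℝ≥0∞) + 1)⁻¹)) with hh
  have hpos : ∀ k : ℕ, ((k : ℝ≥0∞) + 1)⁻¹ ≠ 0 := fun k => by simp
  have h_cont : ∀ k, Continuous (h k) := by
    intro k
    refine continuous_const.min (continuous_iff_continuousAt.2 fun z => ?_)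
    refine ENNReal.Tendsto.mul (((continuous_expLoss hη).comp hf).tendsto z)
      (Or.inl (expLoss_ne_zero hη _))
      (((continuous_discount hη hmeas hcont).add continuous_const).tendsto z) (Or.inl ?_)
    exact ((pos_iff_ne_zero.2 (hpos k)).trans_le le_add_self).ne'
  have h_anti : Antitone h := by
    intro k m hkm z
    simp only [hh]
    gcongr
  have h_inf : ∀ z, ⨅ k, h k z = min (b : ℝ≥0∞) (xi ℓ F η Q f z) := by
    intro z
    by_cases hz : ℓ f z = ∞
    · simp [hh, hz, expLoss_top hη, xi_of_eq_top hz, ENNReal.top_mul]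
    · have hlim : Tendsto (fun k => h k z) atTop (𝓝 (min (b : ℝ≥0∞) (xi ℓ F η Q f z))) := by
        rw [xi_of_ne_top hη hz]
        refine tendsto_const_nhds.min (ENNReal.Tendsto.const_mul ?_
          (Or.inr (mt (expLoss_eq_top_iff hη).1 hz)))
        have : Tendsto (fun k : ℕ => ((k : ℝ≥0∞) + 1)⁻¹) atTop (𝓝 0) := by
          have := (tendsto_add_atTop_iff_nat 1).2 ENNReal.tendsto_inv_nat_nhds_zero
          simpa using this
        simpa using this.const_add (discount ℓ F η Q z)
      exact tendsto_nhds_unique (tendsto_atTop_iInf fun _ _ hkm => h_anti hkm z) hlim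
  have h_le : ∀ k z, h k z ≤ b := fun k z => min_le_left _ _
  have heq : (fun P : ProbabilityMeasure Z =>
      ∫⁻ z, min (b : ℝ≥0∞) (xi ℓ F η Q f z) ∂(P : Measure Z)) =
      fun P : ProbabilityMeasure Z => ⨅ k, ∫⁻ z, h k z ∂(P : Measure Z) := by
    ext P
    rw [← lintegral_iInf (fun k => (h_cont k).measurable) h_anti]
    · simp only [h_inf]
    · refine ne_top_of_le_ne_top (b := (b : ℝ≥0∞)) ENNReal.coe_ne_top ?_
      calc ∫⁻ z, h 0 z ∂(P : Measure Z) ≤ ∫⁻ _, (b : ℝ≥0∞) ∂(P : Measure Z) :=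
            lintegral_mono (h_le 0)
        _ = b := by simp
  rw [heq]
  refine upperSemicontinuous_iInf fun k => Continuous.upperSemicontinuous ?_
  have hne : ∀ z, h k z ≠ ∞ := fun z => ne_top_of_le_ne_top ENNReal.coe_ne_top (h_le k z)
  let hb : BoundedContinuousFunction Z ℝ≥0 :=
    BoundedContinuousFunction.mkOfBound
      ⟨fun z => (h k z).toNNReal,
        continuous_iff_continuousAt.2 fun z =>
          (ENNReal.tendsto_toNNReal (hne z)).comp ((h_cont k).tendsto z)⟩ b (by
        intro x y
        have hx : (h k x).toNNReal ≤ b := ENNReal.toNNReal_mono ENNReal.coe_ne_top (h_le k x)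
        have hy : (h k y).toNNReal ≤ b := ENNReal.toNNReal_mono ENNReal.coe_ne_top (h_le k y)
        rw [NNReal.dist_eq, abs_sub_le_iff]
        have hx' : ((h k x).toNNReal : ℝ) ≤ b := by exact_mod_cast hx
        have hy' : ((h k y).toNNReal : ℝ) ≤ b := by exact_mod_cast hy
        exact ⟨by simp only [ContinuousMap.coe_mk]; linarith [(h k y).toNNReal.coe_nonneg],
          by simp only [ContinuousMap.coe_mk]; linarith [(h k x).toNNReal.coe_nonneg]⟩)
  have := ProbabilityMeasure.continuous_lintegral_boundedContinuousFunction hb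
  refine this.congr fun P => lintegral_congr fun z => ?_
  exact ENNReal.coe_toNNReal (hne z)

variable [AddCommGroup V] [Module ℝ V]

/-- The tail expectations of the gap are uniformly small. -/
theorem AssumptionD.exists_tail_le (hD : AssumptionD ℓ Ps F FD η Q) {ε : ℝ≥0∞} (hε : 0 < ε) :
    ∃ b : ℝ≥0, ∀ f ∈ FD, ∀ P ∈ Ps, ∫⁻ z, {z | (b : ℝ≥0∞) ≤ xi ℓ F η Q f z}.indicator
      (xi ℓ F η Q f) z ∂(P : Measure Z) ≤ ε := by
  obtain ⟨b, hb⟩ := (hD.uniformly_integrable.eventually (eventually_le_nhds hε)).exists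
  refine ⟨b.toNNReal, fun f hf P hP => le_trans ?_ hb⟩
  exact le_iSup₂_of_le f hf (le_iSup₂_of_le P hP le_rfl)

variable [FirstCountableTopology Z]

theorem AssumptionD.measurable_xi (hD : AssumptionD ℓ Ps F FD η Q) (hη : 0 < η)
    (hmeas : ∀ z : Z, Measurable fun g : F => ℓ g z) {f : V} (hf : f ∈ F ∪ FD) :
    Measurable (xi ℓ F η Q f) :=
  FastRates.measurable_xi hη hmeas (fun g hg => hD.continuous_loss g (Or.inl hg))
    (hD.continuous_loss f hf)

theorem AssumptionD.setLIntegral_xi_le (hD : AssumptionD ℓ Ps F FD η Q) (hη : 0 < η)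
    (hmeas : ∀ z : Z, Measurable fun g : F => ℓ g z) {f : V} (hf : f ∈ FD)
    (P : ProbabilityMeasure Z) (b : ℝ≥0) (A : Set Z) :
    ∫⁻ z in A, xi ℓ F η Q f z ∂(P : Measure Z) ≤
      (∫⁻ z in A, min (b : ℝ≥0∞) (xi ℓ F η Q f z) ∂(P : Measure Z)) +
      ∫⁻ z, {z | (b : ℝ≥0∞) ≤ xi ℓ F η Q f z}.indicator (xi ℓ F η Q f) z ∂(P : Measure Z) := by
  have hm := hD.measurable_xi hη hmeas (Or.inr hf)
  calc ∫⁻ z in A, xi ℓ F η Q f z ∂(P : Measure Z)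
      ≤ ∫⁻ z in A, (min (b : ℝ≥0∞) (xi ℓ F η Q f z) +
          {z | (b : ℝ≥0∞) ≤ xi ℓ F η Q f z}.indicator (xi ℓ F η Q f) z) ∂(P : Measure Z) := by
        refine lintegral_mono fun z => ?_
        by_cases hz : (b : ℝ≥0∞) ≤ xi ℓ F η Q f z
        · simp [indicator, hz]
        · simp [indicator, hz, min_eq_right (not_le.1 hz).le]
    _ = _ := lintegral_add_left (measurable_const.min hm) _
    _ ≤ _ := by
      gcongr
      exact Measure.restrict_le_self

theorem AssumptionD.S_le (hD : AssumptionD ℓ Ps F FD η Q) (hη : 0 < η)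
    (hmeas : ∀ z : Z, Measurable fun g : F => ℓ g z) {f : V} (hf : f ∈ FD)
    (P : ProbabilityMeasure Z) (b : ℝ≥0) :
    S ℓ F η Q P f ≤ (∫⁻ z, min (b : ℝ≥0∞) (xi ℓ F η Q f z) ∂(P : Measure Z)) +
      ∫⁻ z, {z | (b : ℝ≥0∞) ≤ xi ℓ F η Q f z}.indicator (xi ℓ F η Q f) z ∂(P : Measure Z) := by
  simpa [S] using hD.setLIntegral_xi_le hη hmeas hf P b univ

theorem AssumptionD.S_ne_top (hD : AssumptionD ℓ Ps F FD η Q) (hη : 0 < η)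
    (hmeas : ∀ z : Z, Measurable fun g : F => ℓ g z) {f : V} (hf : f ∈ FD)
    {P : ProbabilityMeasure Z} (hP : P ∈ Ps) : S ℓ F η Q P f ≠ ∞ := by
  obtain ⟨b, hb⟩ := hD.exists_tail_le one_pos
  refine ne_top_of_le_ne_top ?_ ((hD.S_le hη hmeas hf P b).trans
    (add_le_add (lintegral_mono fun z => min_le_left _ _) (hb f hf P hP)))
  simp

/-- The expected gap is upper semicontinuous in the distribution, on `Ps`. -/
theorem AssumptionD.eventually_S_lt (hD : AssumptionD ℓ Ps F FD η Q) (hη : 0 < η)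
    (hmeas : ∀ z : Z, Measurable fun g : F => ℓ g z) {f : V} (hf : f ∈ FD)
    (P : ProbabilityMeasure Z) {c : ℝ≥0∞} (hc : S ℓ F η Q P f < c) :
    ∀ᶠ P' in 𝓝 P, P' ∈ Ps → S ℓ F η Q P' f < c := by
  -- The truncated integral stays below `c'`, the tail gets the budget `d - c'`, and `d < c` keeps
  -- the inequality strict.
  obtain ⟨c', hc', hc'c⟩ := exists_between hc
  obtain ⟨d, hc'd, hdc⟩ := exists_between hc'c
  obtain ⟨b, hb⟩ := hD.exists_tail_le (tsub_pos_of_lt hc'd)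
  have hlt : ∫⁻ z, min (b : ℝ≥0∞) (xi ℓ F η Q f z) ∂(P : Measure Z) < c' :=
    lt_of_le_of_lt (lintegral_mono fun z => min_le_right _ _) hc'
  filter_upwards [lintegral_min_upperSemicontinuous hη hmeas
    (fun g hg => hD.continuous_loss g (Or.inl hg)) (hD.continuous_loss f (Or.inr hf)) b P c' hlt]
    with P' hP' hP'mem
  calc S ℓ F η Q P' f ≤ _ := hD.S_le hη hmeas hf P' b
    _ ≤ c' + (d - c') := add_le_add hP'.le (hb f hf P' hP'mem)
    _ = d := add_tsub_cancel_of_le hc'd.le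
    _ < c := hdc

/-- If no single decision attains the level `c` uniformly, then for finitely many decisions some
distribution exceeds `c` at all of them. -/
theorem AssumptionD.exists_forall_lt (hD : AssumptionD ℓ Ps F FD η Q) (hη : 0 < η)
    (hmeas : ∀ z : Z, Measurable fun g : F => ℓ g z) (hne : FD.Nonempty) {c : ℝ≥0∞}
    (hc : c < ⨅ f ∈ FD, ⨆ P ∈ Ps, S ℓ F η Q P f) {s : Set V} (hs : s.Finite) (hsFD : s ⊆ FD) :
    ∃ P ∈ Ps, ∀ f ∈ s, c < S ℓ F η Q P f := by
  have hfin := fun {f} (hf : f ∈ FD) {P} (hP : P ∈ Ps) => hD.S_ne_top hη hmeas hf hP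
  have hctop : c ≠ ∞ := hc.ne_top
  have := hs.fintype
  have hlt : ∀ f ∈ FD, ∃ P ∈ Ps, c.toReal < (S ℓ F η Q P f).toReal := by
    intro f hf
    obtain ⟨P, hP, hlt⟩ := lt_biSup_iff.1 (hc.trans_le (iInf₂_le f hf))
    exact ⟨P, hP, (ENNReal.toReal_lt_toReal hctop (hfin hf hP)).2 hlt⟩
  have hconv : ∀ P ∈ Ps, ConvexOn ℝ FD fun f => (S ℓ F η Q P f).toReal := by
    refine fun P hP => ⟨hD.convex_decisions, fun f hf g hg a b ha hb hab => ?_⟩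
    lift a to ℝ≥0 using ha
    lift b to ℝ≥0 using hb
    have hm := fun {f} (hf : f ∈ FD) => hD.measurable_xi hη hmeas (f := f) (Or.inr hf)
    have hle : S ℓ F η Q P ((a : ℝ) • f + (b : ℝ) • g) ≤
        a * S ℓ F η Q P f + b * S ℓ F η Q P g := by
      simp only [S]
      rw [← lintegral_const_mul _ (hm hf), ← lintegral_const_mul _ (hm hg),
        ← lintegral_add_left ((hm hf).const_mul _)]
      exact lintegral_mono fun z => xi_convex hη hD.convex_expLoss hf hg (by exact_mod_cast hab) z
    have h1 : (a : ℝ≥0∞) * S ℓ F η Q P f ≠ ∞ := ENNReal.mul_ne_top ENNReal.coe_ne_top (hfin hf hP)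
    have h2 : (b : ℝ≥0∞) * S ℓ F η Q P g ≠ ∞ := ENNReal.mul_ne_top ENNReal.coe_ne_top (hfin hg hP)
    have := ENNReal.toReal_mono (ENNReal.add_ne_top.2 ⟨h1, h2⟩) hle
    rwa [ENNReal.toReal_add h1 h2, ENNReal.toReal_mul, ENNReal.toReal_mul] at this
  have hmix : ∀ P ∈ Ps, ∀ P' ∈ Ps, ∀ a b : ℝ, 0 ≤ a → 0 ≤ b → a + b = 1 → ∃ R ∈ Ps, ∀ f ∈ FD,
      a * (S ℓ F η Q P f).toReal + b * (S ℓ F η Q P' f).toReal ≤ (S ℓ F η Q R f).toReal := by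
    intro P hP P' hP' a b ha hb hab
    lift a to ℝ≥0 using ha
    lift b to ℝ≥0 using hb
    obtain ⟨R, hR, hRe⟩ := hD.convex_distributions (mem_image_of_mem _ hP) (mem_image_of_mem _ hP')
      (zero_le : 0 ≤ a) (zero_le : 0 ≤ b) (by exact_mod_cast hab)
    refine ⟨R, hR, fun f hf => le_of_eq ?_⟩
    have h1 : (a : ℝ≥0∞) * S ℓ F η Q P f ≠ ∞ := ENNReal.mul_ne_top ENNReal.coe_ne_top (hfin hf hP)
    have h2 : (b : ℝ≥0∞) * S ℓ F η Q P' f ≠ ∞ :=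
      ENNReal.mul_ne_top ENNReal.coe_ne_top (hfin hf hP')
    simp only [S_mix hRe, ENNReal.toReal_add h1 h2, ENNReal.toReal_mul, ENNReal.coe_toReal]
  obtain ⟨P, hP, h⟩ := exists_forall_lt_of_convexOn hne hconv hmix hlt
    (fun f : s => (f : V)) (fun f => hsFD f.2)
  exact ⟨P, hP, fun f hf => (ENNReal.toReal_lt_toReal hctop (hfin (hsFD hf) hP)).1 (h ⟨f, hf⟩)⟩

/-! ### The minimax identity -/

/-- If the bound failed, each `P` would have a decision with gap below `c`, still so near `P`. By
compactness finitely many such decisions serve all of `Ps`, against `exists_forall_lt`. -/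
theorem AssumptionD.le_iSup_iInf_of_isClosed [T2Space Z] (hD : AssumptionD ℓ Ps F FD η Q)
    (hη : 0 < η) (hmeas : ∀ z : Z, Measurable fun g : F => ℓ g z) (hne : FD.Nonempty)
    (hcl : IsClosed Ps) {c : ℝ≥0∞} (hc : c < ⨅ f ∈ FD, ⨆ P ∈ Ps, S ℓ F η Q P f) :
    c ≤ ⨆ P ∈ Ps, ⨅ f ∈ FD, S ℓ F η Q P f := by
  have hcomp : IsCompact Ps := by
    have := isCompact_closure_of_isTightMeasureSet (S := Ps) hD.tight
    rwa [hcl.closure_eq] at this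
  by_contra! hcon
  have hex : ∀ P, ∃ f, P ∈ Ps → f ∈ FD ∧ S ℓ F η Q P f < c := by
    intro P
    by_cases hP : P ∈ Ps
    · have h := (le_iSup₂ (f := fun P (_ : P ∈ Ps) => ⨅ f ∈ FD, S ℓ F η Q P f) P hP).trans_lt hcon
      obtain ⟨f, hf, hlt⟩ : ∃ f, ∃ _ : f ∈ FD, S ℓ F η Q P f < c := by
        simpa only [iInf_lt_iff] using h
      exact ⟨f, fun _ => ⟨hf, hlt⟩⟩
    · exact ⟨0, fun h => absurd h hP⟩
  choose y hy using hex
  obtain ⟨t, ht, hcov⟩ := hcomp.elim_nhds_subcover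
    (fun P => {P' | P' ∈ Ps → S ℓ F η Q P' (y P) < c})
    fun P hP => hD.eventually_S_lt hη hmeas (hy P hP).1 P (hy P hP).2
  obtain ⟨P, hP, hlt⟩ := hD.exists_forall_lt hη hmeas hne hc (t.finite_toSet.image y)
    (by rintro _ ⟨P, hP, rfl⟩; exact (hy P (ht P hP)).1)
  obtain ⟨P', hP', hmem⟩ := mem_iUnion₂.1 (hcov hP)
  exact lt_asymm (hlt _ (mem_image_of_mem y hP')) (hmem hP)

/-- A distribution exceeding `c` on a fine enough finite net has gap at least `d'` at every
decision. -/
theorem AssumptionD.le_iSup_iInf_of_equicontinuous [T2Space Z] (hD : AssumptionD ℓ Ps F FD η Q)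
    (hη : 0 < η) (hmeas : ∀ z : Z, Measurable fun g : F => ℓ g z) (hne : FD.Nonempty)
    (hequi : TotallyBoundedEquicontinuous ℓ FD) {c : ℝ≥0∞}
    (hc : c < ⨅ f ∈ FD, ⨆ P ∈ Ps, S ℓ F η Q P f) :
    c ≤ ⨆ P ∈ Ps, ⨅ f ∈ FD, S ℓ F η Q P f := by
  refine le_of_forall_lt fun d hdc => ?_
  obtain ⟨d', hdd', hd'c⟩ := exists_between hdc
  refine hdd'.trans_le ?_
  -- an accuracy `ε` for which `e ^ (η ε) d' + 2 ε ≤ c`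
  obtain ⟨ε, hε, hεc⟩ : ∃ ε : ℝ, 0 < ε ∧ ENNReal.ofReal (Real.exp (η * ε)) * d' +
      (ENNReal.ofReal ε + ENNReal.ofReal ε) < c := by
    have hlim : Tendsto (fun ε : ℝ => ENNReal.ofReal (Real.exp (η * ε)) * d' +
        (ENNReal.ofReal ε + ENNReal.ofReal ε)) (𝓝[>] 0) (𝓝 d') := by
      have hcont : Continuous fun ε : ℝ => ENNReal.ofReal (Real.exp (η * ε)) * d' +
          (ENNReal.ofReal ε + ENNReal.ofReal ε) := by
        refine Continuous.add ?_ (ENNReal.continuous_ofReal.add ENNReal.continuous_ofReal)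
        exact (ENNReal.continuous_mul_const hd'c.ne_top).comp
          (ENNReal.continuous_ofReal.comp (by fun_prop))
      simpa using (hcont.tendsto 0).mono_left nhdsWithin_le_nhds
    obtain ⟨ε, h1, h2⟩ := ((hlim.eventually_lt_const hd'c).and self_mem_nhdsWithin).exists
    exact ⟨ε, h2, h1⟩
  have hε' : 0 < ENNReal.ofReal ε := ENNReal.ofReal_pos.2 hε
  obtain ⟨b, hb⟩ := hD.exists_tail_le hε'
  -- Off `K` the gap truncated at `b` then contributes at most `ε`; the `+ 1` covers `b = 0`.
  obtain ⟨K, hK, hKle⟩ := isTightMeasureSet_iff_exists_isCompact_measure_compl_le.1 hD.tight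
    (ENNReal.ofReal ε / (b + 1)) (ENNReal.div_pos hε'.ne' (by simp))
  obtain ⟨_, htb, heq⟩ := hequi
  obtain ⟨δ, hδ, hδle⟩ := heq K hK ε hε
  obtain ⟨t, htfin, htcov⟩ := Metric.totallyBounded_iff.1 htb δ hδ
  obtain ⟨P, hP, hlt⟩ := hD.exists_forall_lt hη hmeas hne hc (htfin.image Subtype.val)
    (by rintro _ ⟨f, -, rfl⟩; exact f.2)
  refine le_iSup₂_of_le P hP (le_iInf₂ fun f hf => ?_)
  by_contra! hcon
  obtain ⟨g, hg, hfg⟩ := mem_iUnion₂.1 (htcov (mem_univ ⟨f, hf⟩))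
  rw [Metric.mem_ball, dist_comm] at hfg
  refine lt_asymm hεc (lt_of_lt_of_le (hlt g (mem_image_of_mem _ hg)) ?_)
  have hKm : MeasurableSet K := hK.measurableSet
  calc S ℓ F η Q P g
      = (∫⁻ z in K, xi ℓ F η Q g z ∂(P : Measure Z)) +
          ∫⁻ z in Kᶜ, xi ℓ F η Q g z ∂(P : Measure Z) := (lintegral_add_compl _ hKm).symm
    _ ≤ ENNReal.ofReal (Real.exp (η * ε)) * S ℓ F η Q P f +
          (ENNReal.ofReal ε + ENNReal.ofReal ε) := by
        gcongr
        · rw [S, ← lintegral_const_mul _ (hD.measurable_xi hη hmeas (Or.inr hf))]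
          exact (setLIntegral_mono' hKm fun z hz =>
            xi_le_of_le_add hη hε.le (hδle g ⟨f, hf⟩ hfg z hz)).trans (setLIntegral_le_lintegral _ _)
        · refine (hD.setLIntegral_xi_le hη hmeas g.2 P b Kᶜ).trans
            (add_le_add ?_ (hb g g.2 P hP))
          calc ∫⁻ z in Kᶜ, min (b : ℝ≥0∞) (xi ℓ F η Q g z) ∂(P : Measure Z)
              ≤ ∫⁻ _ in Kᶜ, (b : ℝ≥0∞) ∂(P : Measure Z) :=
                lintegral_mono fun z => min_le_left _ _
            _ = b * (P : Measure Z) Kᶜ := by simp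
            _ ≤ (b + 1) * (ENNReal.ofReal ε / (b + 1)) := by
                gcongr
                · exact le_self_add
                · exact hKle _ (mem_image_of_mem _ hP)
            _ = ENNReal.ofReal ε := ENNReal.mul_div_cancel (by simp) (by simp)
    _ ≤ _ := by gcongr

theorem AssumptionD.minimaxIdentity [T2Space Z] (hD : AssumptionD ℓ Ps F FD η Q) (hη : 0 < η)
    (hmeas : ∀ z : Z, Measurable fun g : F => ℓ g z) (hne : FD.Nonempty) :
    MinimaxIdentity ℓ Ps F FD η Q := by
  refine le_antisymm ?_ (le_of_forall_lt_imp_le_of_dense fun c hc => ?_)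
  · exact iSup₂_le fun P hP => le_iInf₂ fun f hf =>
      (iInf₂_le f hf).trans (le_iSup₂ (f := fun P (_ : P ∈ Ps) => S ℓ F η Q P f) P hP)
  · rcases hD.closed_or_equicontinuous with hcl | hequi
    · exact hD.le_iSup_iInf_of_isClosed hη hmeas hne hcl hc
    · exact hD.le_iSup_iInf_of_equicontinuous hη hmeas hne hequi hc

end Minimax

end FastRates

namespace FastRates

/-! ### From the central condition to the predictor condition -/

section Central

variable {V Z : Type*} [MeasurableSpace V] {η : ℝ}

/-- Quantitative form of `1 + x ≤ e ^ x` for the excess loss: the defect controls the distance of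
`e ^ (x / 2)` from `1`. -/
theorem sq_add_one_add_le_expExcess (hη : 0 < η) {a c : ℝ≥0∞} (ha : a ≠ ∞) :
    ENNReal.ofReal ((Real.exp (η * (c.toReal - a.toReal) / 2) - 1) ^ 2) + 1 +
      ENNReal.ofReal η * c ≤ expExcess η c a + ENNReal.ofReal η * a := by
  by_cases hc : c = ∞
  · simp [hc, expExcess_top]
  rw [expExcess_of_ne_top hη hc, expLoss_of_ne_top hc, expLoss_of_ne_top ha,
    ← ENNReal.ofReal_inv_of_pos (Real.exp_pos _), ← ENNReal.ofReal_mul (Real.exp_nonneg _),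
    ← Real.exp_neg, ← Real.exp_add]
  lift a to ℝ≥0 using ha
  lift c to ℝ≥0 using hc
  simp only [ENNReal.coe_toReal]
  rw [← ENNReal.ofReal_coe_nnreal (p := a), ← ENNReal.ofReal_coe_nnreal (p := c),
    ← ENNReal.ofReal_one, ← ENNReal.ofReal_mul hη.le, ← ENNReal.ofReal_mul hη.le,
    ← ENNReal.ofReal_add (by positivity) (by positivity),
    ← ENNReal.ofReal_add (by positivity) (by positivity),
    ← ENNReal.ofReal_add (by positivity) (by positivity)]
  refine ENNReal.ofReal_le_ofReal ?_
  set x : ℝ := η * ((c : ℝ) - a) / 2 with hx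
  have h1 : η * (c : ℝ) + -(η * (a : ℝ)) = x + x := by rw [hx]; ring
  have h2 : η * (c : ℝ) = η * a + 2 * x := by rw [hx]; ring
  rw [h1, h2, Real.exp_add]
  -- After expanding the square, the claim is `2 + 2 * x ≤ 2 * e ^ x`.
  nlinarith [Real.add_one_le_exp x]

theorem xi_dirac {ℓ : V → Z → ℝ≥0∞} {F : Set V} (hη : 0 < η)
    (hmeas : ∀ z : Z, Measurable fun g : F => ℓ g z) (g : F) (f : V) (z : Z) :
    xi ℓ F η (diracProba g) f z = expExcess η (ℓ f z) (ℓ g z) := by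
  by_cases hf : ℓ f z = ∞
  · rw [xi_of_eq_top hf, hf, expExcess_top]
  · rw [xi_of_ne_top hη hf, expExcess_of_ne_top hη hf]
    congr 1
    exact lintegral_dirac' g ((continuous_expLoss hη).measurable.comp (hmeas z)).inv

variable [TopologicalSpace Z] [FirstCountableTopology Z] [MeasurableSpace Z] [BorelSpace Z]
  {ℓ : V → Z → ℝ≥0∞} {F : Set V}

/-- If the central condition holds at `P` at every level, then a risk minimizer over `F` satisfies
it at level zero. -/
theorem S_le_one_of_risk_minimizer (hη : 0 < η)
    (hmeas : ∀ z : Z, Measurable fun g : F => ℓ g z) (hcont : ∀ f ∈ F, Continuous (ℓ f))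
    {P : ProbabilityMeasure Z}
    (hcentral : ∀ ε : ℝ, 0 < ε → ∃ f ∈ F, ∀ Q : ProbabilityMeasure F,
      S ℓ F η Q P f ≤ ENNReal.ofReal (Real.exp (η * ε)))
    {f₀ : V} (hf₀ : f₀ ∈ F) (hmin : ∀ f ∈ F, risk ℓ P f₀ ≤ risk ℓ P f)
    (hfin : risk ℓ P f₀ < ∞) (Q : ProbabilityMeasure F) : S ℓ F η Q P f₀ ≤ 1 := by
  have hseq : ∀ n : ℕ, ∃ f ∈ F, ∀ Q : ProbabilityMeasure F,
      S ℓ F η Q P f ≤ 1 + 2⁻¹ ^ n := by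
    intro n
    have hp : (0 : ℝ) < 2⁻¹ ^ n := by positivity
    -- The level is chosen so that `e ^ (η ε) = 1 + 2⁻¹ ^ n`, a summable excess.
    obtain ⟨f, hf, h⟩ := hcentral (Real.log (1 + 2⁻¹ ^ n) / η)
      (div_pos (Real.log_pos (by linarith)) hη)
    refine ⟨f, hf, fun Q => (h Q).trans_eq ?_⟩
    rw [mul_div_cancel₀ _ hη.ne', Real.exp_log (by linarith),
      ENNReal.ofReal_add zero_le_one hp.le, ENNReal.ofReal_one, ENNReal.ofReal_pow (by norm_num),
      ENNReal.ofReal_inv_of_pos two_pos, ENNReal.ofReal_ofNat]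
  choose f hfF hf using hseq
  set h : ℕ → Z → ℝ≥0∞ := fun n z => ENNReal.ofReal
    ((Real.exp (η * ((ℓ (f n) z).toReal - (ℓ f₀ z).toReal) / 2) - 1) ^ 2) with hh
  have hm : ∀ g ∈ F, Measurable (ℓ g) := fun g hg => (hcont g hg).measurable
  have hh_meas : ∀ n, Measurable (h n) := fun n =>
    ((((((hm _ (hfF n)).ennreal_toReal.sub (hm _ hf₀).ennreal_toReal).const_mul η).div_const
      2).exp.sub_const 1).pow_const 2).ennreal_ofReal
  have hae₀ : ∀ᵐ z ∂(P : Measure Z), ℓ f₀ z ≠ ∞ :=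
    (ae_lt_top (hm _ hf₀) hfin.ne).mono fun z hz => hz.ne
  have hexc : ∀ n, ∫⁻ z, expExcess η (ℓ (f n) z) (ℓ f₀ z) ∂(P : Measure Z) ≤ 1 + 2⁻¹ ^ n := by
    intro n
    -- The point mass at `f₀` turns the central condition into a direct comparison of `f n` with
    -- `f₀`.
    refine le_trans (le_of_eq ?_) (hf n (diracProba ⟨f₀, hf₀⟩))
    exact lintegral_congr fun z => (xi_dirac hη hmeas ⟨f₀, hf₀⟩ (f n) z).symm
  have hint : ∀ n, ∫⁻ z, h n z ∂(P : Measure Z) ≤ 2⁻¹ ^ n := by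
    intro n
    have h1 := lintegral_mono_ae (hae₀.mono fun z hz =>
      sq_add_one_add_le_expExcess (c := ℓ (f n) z) hη hz)
    rw [lintegral_add_right _ ((hm _ (hfF n)).const_mul _), lintegral_add_right _ measurable_const,
      lintegral_add_right _ ((hm _ hf₀).const_mul _), lintegral_const_mul _ (hm _ (hfF n)),
      lintegral_const_mul _ (hm _ hf₀), lintegral_one, measure_univ] at h1
    -- Minimality of `f₀` makes the mean excess loss nonnegative; its finite risk then cancels.
    have h2 : (∫⁻ z, h n z ∂(P : Measure Z)) + (1 + ENNReal.ofReal η * risk ℓ P f₀) ≤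
        2⁻¹ ^ n + (1 + ENNReal.ofReal η * risk ℓ P f₀) := by
      calc (∫⁻ z, h n z ∂(P : Measure Z)) + (1 + ENNReal.ofReal η * risk ℓ P f₀)
          ≤ (∫⁻ z, h n z ∂(P : Measure Z)) + (1 + ENNReal.ofReal η * risk ℓ P (f n)) := by
            gcongr
            exact hmin _ (hfF n)
        _ ≤ (1 + 2⁻¹ ^ n) + ENNReal.ofReal η * risk ℓ P f₀ := by
            rw [← add_assoc]
            exact h1.trans (by gcongr; exacts [hexc n, le_rfl])
        _ = _ := by ring
    exact (ENNReal.add_le_add_iff_right (ENNReal.add_ne_top.2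
      ⟨ENNReal.one_ne_top, ENNReal.mul_ne_top ENNReal.ofReal_ne_top hfin.ne⟩)).1 h2
  -- Summability gives almost sure convergence of `h n` along the whole sequence.
  have hsum : ∫⁻ z, ∑' n, h n z ∂(P : Measure Z) ≠ ∞ := by
    rw [lintegral_tsum fun n => (hh_meas n).aemeasurable]
    refine ne_top_of_le_ne_top ?_ (ENNReal.tsum_le_tsum hint)
    rw [ENNReal.tsum_geometric]
    simp
  have hae_sum : ∀ᵐ z ∂(P : Measure Z), ∑' n, h n z < ∞ :=
    ae_lt_top (Measurable.tsum hh_meas) hsum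
  have hae : ∀ᵐ z ∂(P : Measure Z), ∀ n, ℓ (f n) z ≠ ∞ := by
    refine ae_all_iff.2 fun n => ?_
    have hmx : Measurable fun z => expExcess η (ℓ (f n) z) (ℓ f₀ z) := by
      simp only [← xi_dirac hη hmeas ⟨f₀, hf₀⟩ (f n)]
      exact measurable_xi hη hmeas hcont (hcont _ (hfF n))
    have hne : ∫⁻ z, expExcess η (ℓ (f n) z) (ℓ f₀ z) ∂(P : Measure Z) ≠ ∞ :=
      ne_top_of_le_ne_top (by finiteness) (hexc n)
    filter_upwards [ae_lt_top hmx hne] with z hz htop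
    rw [htop, expExcess_top] at hz
    exact lt_irrefl _ hz
  have hlim : ∀ᵐ z ∂(P : Measure Z),
      Tendsto (fun n => xi ℓ F η Q (f n) z) atTop (𝓝 (xi ℓ F η Q f₀ z)) := by
    filter_upwards [hae₀, hae, hae_sum] with z hz₀ hz hzs
    simp only [xi_of_ne_top hη hz₀, xi_of_ne_top hη (hz _)]
    refine ENNReal.Tendsto.mul_const ?_ (Or.inr (discount_ne_top hη z))
    simp only [expLoss_of_ne_top hz₀, expLoss_of_ne_top (hz _)]
    refine ENNReal.tendsto_ofReal ?_
    have h0 : Tendsto (fun n => h n z) atTop (𝓝 0) :=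
      ENNReal.tendsto_atTop_zero_of_tsum_ne_top hzs.ne
    set y : ℕ → ℝ := fun n => Real.exp (η * ((ℓ (f n) z).toReal - (ℓ f₀ z).toReal) / 2) with hy
    have h1 : Tendsto (fun n => (y n - 1) ^ 2) atTop (𝓝 0) := by
      have := (ENNReal.tendsto_toReal ENNReal.zero_ne_top).comp h0
      refine this.congr fun n => ?_
      simp only [hh, Function.comp, hy]
      exact ENNReal.toReal_ofReal (sq_nonneg _)
    have h2 : Tendsto (fun n => y n - 1) atTop (𝓝 0) := by
      have := h1.sqrt
      simp only [Real.sqrt_sq_eq_abs, Real.sqrt_zero] at this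
      exact (tendsto_zero_iff_abs_tendsto_zero _).2 this
    have h3 : Tendsto y atTop (𝓝 1) := by simpa using h2.add_const 1
    have h4 := (h3.pow 2).const_mul (Real.exp (η * (ℓ f₀ z).toReal))
    rw [one_pow, mul_one] at h4
    refine h4.congr fun n => ?_
    rw [hy, sq, ← Real.exp_add, ← Real.exp_add]
    congr 1
    ring
  calc S ℓ F η Q P f₀
      = ∫⁻ z, liminf (fun n => xi ℓ F η Q (f n) z) atTop ∂(P : Measure Z) :=
        lintegral_congr_ae (hlim.mono fun z hz => hz.liminf_eq.symm)
    _ ≤ liminf (fun n => S ℓ F η Q P (f n)) atTop :=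
        lintegral_liminf_le fun n => measurable_xi hη hmeas hcont (hcont _ (hfF n))
    _ ≤ liminf (fun n : ℕ => (1 : ℝ≥0∞) + 2⁻¹ ^ n) atTop :=
        liminf_le_liminf (Eventually.of_forall fun n => hf n Q)
    _ = 1 := by
        have : Tendsto (fun n : ℕ => (1 : ℝ≥0∞) + 2⁻¹ ^ n) atTop (𝓝 (1 + 0)) :=
          (ENNReal.tendsto_pow_atTop_nhds_zero_of_lt_one (by simp)).const_add 1
        simpa using this.liminf_eq

end Central

section Predictor

variable {V Z : Type*} [MeasurableSpace V] [MeasurableSpace Z]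
  {ℓ : V → Z → ℝ≥0∞} {Ps : Set (ProbabilityMeasure Z)} {F FD : Set V} {η : ℝ}

/-- The minimax assumption turns a decision chosen for each `P` into one serving all `P`. The
infimum need not be attained, so level `ε / 2` is used to leave room. -/
theorem MinimaxAssumption.weakPredictor (hη : 0 < η) (hminimax : MinimaxAssumption ℓ Ps F FD η)
    (h : ∀ Q : ProbabilityMeasure F, ∀ P ∈ Ps, ∀ ε : ℝ, 0 < ε →
      ⨅ f ∈ FD, S ℓ F η Q P f ≤ ENNReal.ofReal (Real.exp (η * ε))) :
    WeakPredictor ℓ Ps F FD η := by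
  intro ε hε
  have hex : ∀ Q : ProbabilityMeasure F, ∃ f ∈ FD, ∀ P ∈ Ps,
      S ℓ F η Q P f ≤ ENNReal.ofReal (Real.exp (η * ε)) := by
    intro Q
    have hle := hminimax Q (Real.exp (η * (ε / 2))) (Real.one_le_exp (by positivity))
      (iSup₂_le fun P hP => h Q P hP (ε / 2) (half_pos hε))
    have hlt : ENNReal.ofReal (Real.exp (η * (ε / 2))) < ENNReal.ofReal (Real.exp (η * ε)) := by
      rw [ENNReal.ofReal_lt_ofReal_iff (Real.exp_pos _), Real.exp_lt_exp]
      nlinarith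
    obtain ⟨f, hf, hflt⟩ : ∃ f, ∃ _ : f ∈ FD,
        ⨆ P ∈ Ps, S ℓ F η Q P f < ENNReal.ofReal (Real.exp (η * ε)) := by
      simpa only [iInf_lt_iff] using hle.trans_lt hlt
    exact ⟨f, hf, fun P hP =>
      (le_iSup₂ (f := fun P (_ : P ∈ Ps) => S ℓ F η Q P f) P hP).trans hflt.le⟩
  choose ψ hψ hψle using hex
  exact ⟨fun Q => ⟨ψ Q, hψ Q⟩, fun P Q => hψle Q P P.2⟩

end Predictor

end FastRates

theorem mainTheorem2 {V Z : Type*} [AddCommGroup V] [Module ℝ V] [MeasurableSpace V]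
    [TopologicalSpace Z] [PolishSpace Z] [MeasurableSpace Z] [BorelSpace Z]
    (ℓ : V → Z → ℝ≥0∞) (Ps : Set (ProbabilityMeasure Z)) (F FD : Set V)
    (hmeas : ∀ z : Z, Measurable (fun g : F => ℓ g z))
    (hrisk : ∀ P ∈ Ps, ∃ f ∈ F, FastRates.risk ℓ P f < ∞)
    (hFD : FD.Nonempty) (η : ℝ) (hη : 0 < η) :
    (∀ Q : ProbabilityMeasure F, FastRates.AssumptionD ℓ Ps F FD η Q →
      FastRates.MinimaxIdentity ℓ Ps F FD η Q) ∧
    ((∀ Q : ProbabilityMeasure F, FastRates.AssumptionD ℓ Ps F FD η Q) →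
      FastRates.MinimaxAssumption ℓ Ps F FD η) ∧
    ((∀ Q : ProbabilityMeasure F, FastRates.AssumptionD ℓ Ps F FD η Q) →
      (F = FD ∨ (FD ⊆ F ∧ FastRates.StronglyWellSpecified ℓ Ps F FD)) →
      FastRates.WeakCentral ℓ Ps F η → FastRates.WeakPredictor ℓ Ps F FD η) := by
  have hidentity : ∀ Q : ProbabilityMeasure F, FastRates.AssumptionD ℓ Ps F FD η Q →
      FastRates.MinimaxIdentity ℓ Ps F FD η Q := fun Q hD => hD.minimaxIdentity hη hmeas hFD
  have hassumption : (∀ Q : ProbabilityMeasure F, FastRates.AssumptionD ℓ Ps F FD η Q) →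
      FastRates.MinimaxAssumption ℓ Ps F FD η := fun hD Q C _ hC =>
    ((hidentity Q (hD Q)).symm.le).trans hC
  refine ⟨hidentity, hassumption, fun hD hrel hcentral => ?_⟩
  refine (hassumption hD).weakPredictor hη fun Q P hP ε hε => ?_
  rcases hrel with rfl | ⟨hsub, hws⟩
  · obtain ⟨φ, hφ⟩ := hcentral ε hε
    exact (iInf₂_le _ (φ ⟨P, hP⟩).2).trans (hφ ⟨P, hP⟩ Q)
  · obtain ⟨heq, -, f₀, hf₀, hf₀eq⟩ := hws P hP
    -- Equality of the two infima makes the minimizer over `FD` a minimizer over `F`.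
    have hmin : ∀ f ∈ F, FastRates.risk ℓ P f₀ ≤ FastRates.risk ℓ P f := fun f hf => by
      rw [hf₀eq, ← heq]
      exact iInf₂_le f hf
    obtain ⟨f₁, hf₁, hfin⟩ := hrisk P hP
    have hle := FastRates.S_le_one_of_risk_minimizer hη hmeas
      (fun g hg => (hD Q).continuous_loss g (Or.inl hg))
      (fun ε hε => by
        obtain ⟨φ, hφ⟩ := hcentral ε hε
        exact ⟨φ ⟨P, hP⟩, (φ ⟨P, hP⟩).2, fun Q => hφ ⟨P, hP⟩ Q⟩)
      (hsub hf₀) hmin ((hmin f₁ hf₁).trans_lt hfin) Q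
    refine (iInf₂_le f₀ hf₀).trans (hle.trans ?_)
    rw [ENNReal.one_le_ofReal]
    exact Real.one_le_exp (by positivity)
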